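/- Let $p$ be a prime, let $P$ be a finite $p$-group, let $\mathcal F$ be a saturated fusion system on $P$, and let $\mathcal E$ be a normal subsystem of $\mathcal F$, on a subgroup $Q$ of $P$. This means that $Q$ is strongly $\mathcal F$-closed, that $\mathcal E$ is a saturated fusion system on $Q$ all of whose morphisms lie in $\mathcal F$, and that for all $A\le B\le Q$, $\phi\in\operatorname{Hom}_{\mathcal E}(A,B)$ and $\psi\in\operatorname{Hom}_{\mathcal F}(B,P)$ the homomorphism $\psi^{-1}\phi\psi$ (maps composed from left to right) lies in $\operatorname{Hom}_{\mathcal E}(A\psi,Q)$. For a fusion system $\mathcal G$ on a group $X$ and a subgroup $R\le X$, let $N_{\mathcal G}(R)$ be the system on $N_X(R)$ whose morphisms $A\to B$ (for $A,B\le N_X(R)$) are those $\phi\in\operatorname{Hom}_{\mathcal G}(A,B)$ that extend to some $\bar\phi\in\operatorname{Hom}_{\mathcal G}(RA,RB)$ which restricts to an automorphism of $R$. Suppose that $\mathcal E=N_{\mathcal E}(R)$ for some subgroup $R\le Q$, and let $S$ be the subgroup of $Q$ generated by all $\mathcal F$-conjugates of $R$, that is, by all subgroups of $P$ that are isomorphic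 to $R$ via an isomorphism in $\mathcal F$. Then $\mathcal F=N_{\mathcal F}(S)$. -/

import Mathlib

/-- The image `Aφ` of a homomorphism `φ : A → B` between subgroups of `G`, as a subgroup
of `G`. -/
def imageSubgroup {G : Type*} [Group G] {A B : Subgroup G} (φ : A →* B) :
    Subgroup G :=
  (B.subtype.comp φ).range

/-- The homomorphism `A → Aφ` obtained from `φ : A → B` by restricting the codomain. -/
def toImage {G : Type*} [Group G] {A B : Subgroup G} (φ : A →* B) :
    A →* imageSubgroup φ :=
  (B.subtype.comp φ).rangeRestrict

/-- A prefusion system on a subgroup `carrier` of `G`: for each pair of subgroups `A`, `B` of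
`carrier`, a set `Hom A B` of injective homomorphisms `A → B`. (For subgroups of `G` not
contained in `carrier` the set is empty.) -/
@[ext]
structure PrefusionSystem (G : Type*) [Group G] where
  carrier : Subgroup G
  Hom : ∀ A B : Subgroup G, Set (A →* B)
  le_carrier : ∀ {A B : Subgroup G} {φ : A →* B}, φ ∈ Hom A B → A ≤ carrier ∧ B ≤ carrier
  injective : ∀ {A B : Subgroup G} {φ : A →* B}, φ ∈ Hom A B → Function.Injective φ

/-- A fusion system on the group `carrier`. Conjugation by `g` is `θ_g : a ↦ g⁻¹ a g`. -/
structure FusionSystem (G : Type*) [Group G] extends PrefusionSystem G where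
  comp_mem : ∀ {A B C : Subgroup G} {φ : A →* B} {ψ : B →* C},
    φ ∈ Hom A B → ψ ∈ Hom B C → ψ.comp φ ∈ Hom A C
  conj_mem : ∀ {A B : Subgroup G}, A ≤ carrier → B ≤ carrier → ∀ g ∈ carrier,
    ∀ φ : A →* B, (∀ a : A, (φ a : G) = g⁻¹ * a * g) → φ ∈ Hom A B
  toImage_mem : ∀ {A B : Subgroup G} {φ : A →* B}, φ ∈ Hom A B →
    toImage φ ∈ Hom A (imageSubgroup φ)
  symm_mem : ∀ {A B : Subgroup G} (e : A ≃* B), e.toMonoidHom ∈ Hom A B →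
    e.symm.toMonoidHom ∈ Hom B A

namespace PrefusionSystem

variable {G : Type*} [Group G] (F : PrefusionSystem G)

/-- The normalizer `N_P(A)` of `A` in the group `P` on which `F` is defined. -/
def normalizerIn (A : Subgroup G) : Subgroup G :=
  F.carrier ⊓ Subgroup.normalizer (A : Set G)

/-- `A` and `B` are `F`-conjugate: there is an isomorphism `A → B` in `F`. -/
def IsConjugate (A B : Subgroup G) : Prop :=
  ∃ e : A ≃* B, e.toMonoidHom ∈ F.Hom A B

/-- The normalizer `N_F(R)`: its objects are the subgroups of `N_P(R)`, and its morphisms `A → B`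
are those morphisms `φ : A → B` of `F` that extend to a morphism `φ' : RA → RB` of `F` whose
restriction to `R` is an automorphism of `R`. -/
def normalizer (R : Subgroup G) : PrefusionSystem G where
  carrier := F.normalizerIn R
  Hom A B := {φ | A ≤ F.normalizerIn R ∧ B ≤ F.normalizerIn R ∧ φ ∈ F.Hom A B ∧
    ∃ φ' ∈ F.Hom (R ⊔ A) (R ⊔ B),
      (∀ a : A, (φ' (Subgroup.inclusion le_sup_right a) : G) = φ a) ∧
      ∃ κ : MulAut R, ∀ r : R, (φ' (Subgroup.inclusion le_sup_left r) : G) = κ r}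
  le_carrier h := ⟨h.1, h.2.1⟩
  injective h := F.injective h.2.2.1

/-- `A` is fully normalized: `|N_P(A)| ≥ |N_P(B)|` whenever `A → B` is an isomorphism in `F`. -/
def IsFullyNormalized (A : Subgroup G) : Prop :=
  ∀ B : Subgroup G, F.IsConjugate A B → Nat.card (F.normalizerIn B) ≤ Nat.card (F.normalizerIn A)

/-- `Q` is strongly `F`-closed: every morphism of `F` whose domain is a subgroup of `Q` has
image in `Q`. -/
def IsStronglyClosed (Q : Subgroup G) : Prop :=
  Q ≤ F.carrier ∧ ∀ (A B : Subgroup G), ∀ φ ∈ F.Hom A B, A ≤ Q → imageSubgroup φ ≤ Q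

/-- For a morphism `φ : A → B`, the subgroup `N_φ` of all `x ∈ N_P(A)` for which there is
`y ∈ N_P(Aφ)` with `(a^x)φ = (aφ)^y` for all `a ∈ A`, where `a^x = x⁻¹ a x`. -/
def extensionGroup {A B : Subgroup G} (φ : A →* B) : Subgroup G where
  carrier := {x | x ∈ F.normalizerIn A ∧ ∃ y ∈ F.normalizerIn (imageSubgroup φ),
    ∀ a b : A, (b : G) = x⁻¹ * a * x → (φ b : G) = y⁻¹ * φ a * y}
  one_mem' := by
    refine ⟨one_mem _, 1, one_mem _, fun a b h => ?_⟩
    have : b = a := Subtype.ext (by simpa using h)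
    simp [this]
  mul_mem' := by
    rintro x x' ⟨hx, y, hy, h⟩ ⟨hx', y', hy', h'⟩
    refine ⟨mul_mem hx hx', y * y', mul_mem hy hy', fun a b hab => ?_⟩
    have hc : x⁻¹ * (a : G) * x ∈ A :=
      (Subgroup.mem_normalizer_iff''.1 hx.2 a).1 a.2
    have h1 := h a ⟨_, hc⟩ rfl
    have h2 := h' ⟨_, hc⟩ b (by rw [hab]; group)
    rw [h2, h1]; group
  inv_mem' := by
    rintro x ⟨hx, y, hy, h⟩
    refine ⟨inv_mem hx, y⁻¹, inv_mem hy, fun a b hab => ?_⟩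
    have h1 := h b a (by rw [hab]; group)
    rw [h1]; group

end PrefusionSystem

namespace FusionSystem

variable {G : Type*} [Group G] (F : FusionSystem G)

/-- The group `Aut_F(A)`, for a subgroup `A` of the group on which `F` is defined. -/
def aut (A : Subgroup G) (hA : A ≤ F.carrier) : Subgroup (MulAut A) where
  carrier := {κ | κ.toMonoidHom ∈ F.Hom A A}
  one_mem' := F.conj_mem hA hA 1 (one_mem _) _ fun a => by simp
  mul_mem' h h' := F.comp_mem h' h
  inv_mem' h := F.symm_mem _ h

/-- `F` is saturated: `Aut_P(P)` is a Sylow `p`-subgroup of `Aut_F(P)`, and every morphism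
`φ : A → P` with fully normalized image extends to a morphism `N_φ → P`. -/
structure IsSaturated (p : ℕ) (F : FusionSystem G) : Prop where
  sylow : ∃ T : Sylow p (F.aut F.carrier le_rfl),
    (T : Subgroup (F.aut F.carrier le_rfl)).map (F.aut F.carrier le_rfl).subtype =
      (MulAut.conj : F.carrier →* MulAut F.carrier).range
  extension : ∀ (A : Subgroup G), ∀ φ ∈ F.Hom A F.carrier,
    F.IsFullyNormalized (imageSubgroup φ) →
    ∃ φ' ∈ F.Hom (F.extensionGroup φ) F.carrier,
      ∀ (a : G) (ha : a ∈ A) (ha' : a ∈ F.extensionGroup φ), φ' ⟨a, ha'⟩ = φ ⟨a, ha⟩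

/-- `E` is a subsystem of `F`. -/
def IsSubsystem (E F : FusionSystem G) : Prop :=
  E.carrier ≤ F.carrier ∧ ∀ A B : Subgroup G, E.Hom A B ⊆ F.Hom A B

/-- `E` is a normal subsystem of `F`: it is a subsystem on a strongly `F`-closed subgroup `Q`, it
is saturated, and it is `F`-invariant, i.e. for all `A ≤ B ≤ Q`, all `φ : A → B` in `E` and
all `ψ : B → P` in `F`, the homomorphism `χ = ψ⁻¹φψ : Aψ → Q` (maps composed from left to
right) lies in `E`. -/
structure IsNormalSubsystem (p : ℕ) (E F : FusionSystem G) : Prop where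
  isSubsystem : IsSubsystem E F
  isStronglyClosed : F.IsStronglyClosed E.carrier
  invariant : ∀ (A B : Subgroup G) (hAB : A ≤ B), B ≤ E.carrier →
    ∀ φ ∈ E.Hom A B, ∀ ψ ∈ F.Hom B F.carrier,
    ∃ χ ∈ E.Hom (imageSubgroup (ψ.comp (Subgroup.inclusion hAB))) E.carrier,
      ∀ a : A, (χ (toImage (ψ.comp (Subgroup.inclusion hAB)) a) : G) = ψ (φ a)
  isSaturated : E.IsSaturated p

end FusionSystem

/-!
By a Frattini argument, every `F`-isomorphism between subgroups of `Q` is the composite of the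
restriction of an `F`-automorphism of `Q` with an `E`-isomorphism. Hence all the `F`-conjugates of
`R` are normal in `E`, and so is their join `S`. As `S` is also invariant under the
`F`-automorphisms of `Q`, the same factorization shows that every characteristic subgroup of `S` is
strongly `F`-closed.

In particular `P ≥ S ≥ [S, S] ≥ ⋯ ≥ 1`, continued with the lower central series of `S`, is a chain
of strongly `F`-closed subgroups with factors centralized by `S`. For `C` fully normalized, the
elements of `Aut_F(C)` that stabilize the intersections of this chain with `C` form a normal
`p`-subgroup, which lies in the Sylow subgroup `Aut_P(C)`. Thus every `F`-isomorphism `A → C`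
extends to the product of `A` and `N_S(A)`, which is larger than `A` unless `S ≤ A`, and by
induction every morphism of `F` extends to `S`.
-/

/-! ### Sylow subgroups and stabilizers of chains -/

section GroupTheory

variable {X : Type*} [Group X] {p : ℕ}

theorem lt_inf_normalizer {A B : Subgroup X} [Group.IsNilpotent B] (h : A < B) :
    A < B ⊓ Subgroup.normalizer (A : Set X) := by
  refine lt_of_le_of_ne (le_inf h.le Subgroup.le_normalizer) fun hA => ?_
  have hlt : A.subgroupOf B < Subgroup.normalizer (A.subgroupOf B : Set B) :=
    Group.normalizerCondition_of_isNilpotent _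
      (lt_top_iff_ne_top.2 fun htop => h.not_ge (Subgroup.subgroupOf_eq_top.1 htop))
  rw [← Subgroup.subgroupOf_normalizer_eq h.le] at hlt
  exact hlt.not_ge fun x hx => hA.ge ⟨x.2, hx⟩

theorem lt_sup_inf_normalizer {A S : Subgroup X} [Group.IsNilpotent ↥(S ⊔ A)]
    (hA : A ≤ Subgroup.normalizer (S : Set X)) (hSA : ¬S ≤ A) :
    A < A ⊔ S ⊓ Subgroup.normalizer (A : Set X) := by
  refine (lt_inf_normalizer (right_lt_sup.2 hSA)).trans_le fun x hx => ?_
  have hxSA : x ∈ ((S ⊔ A : Subgroup X) : Set X) := hx.1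
  rw [Subgroup.coe_mul_of_right_le_normalizer_left _ _ hA] at hxSA
  obtain ⟨s, hs, a, ha, rfl⟩ := hxSA
  have hsn : s ∈ Subgroup.normalizer (A : Set X) :=
    (Subgroup.mul_mem_cancel_right _ (Subgroup.le_normalizer ha)).1 hx.2
  exact mul_mem (Subgroup.mem_sup_right ⟨hs, hsn⟩) (Subgroup.mem_sup_left ha)

theorem mem_normalizer_of_forall_conj_mem {A : Subgroup X} [Finite A] {x : X}
    (h : ∀ a ∈ A, x⁻¹ * a * x ∈ A) : x ∈ Subgroup.normalizer (A : Set X) := by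
  have : Finite (A : Set X) := ‹Finite A›
  rw [← inv_mem_iff]
  exact Subgroup.mem_normalizer_fintype fun a ha => by
    rw [inv_inv]; exact h a ha

theorem finite_of_le {A B : Subgroup X} [Finite B] (h : A ≤ B) : Finite A :=
  Finite.of_injective _ (Subgroup.inclusion_injective h)

theorem card_lt_card_of_lt {A B : Subgroup X} [Finite B] (h : A < B) : Nat.card A < Nat.card B :=
  Set.Finite.card_lt_card (Set.toFinite (B : Set X)) h

theorem induction_on_larger_card {P : Subgroup X} [Finite P] {motive : Subgroup X → Prop}
    (h : ∀ A ≤ P, (∀ B ≤ P, Nat.card A < Nat.card B → motive B) → motive A) {A : Subgroup X}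
    (hA : A ≤ P) : motive A := by
  induction hn : Nat.card P - Nat.card A using Nat.strong_induction_on generalizing A with
  | _ n ih =>
  refine h A hA fun B hB hlt => ih _ ?_ hB rfl
  have := Subgroup.card_le_of_le hB
  omega

theorem mem_of_pow_mem {H : Subgroup X} {u : X} {m : ℕ}
    (hm : m.gcd (orderOf u) = 1) (h : u ^ m ∈ H) : u ∈ H :=
  Subgroup.zpowers_le.2 h (mem_zpowers_pow_iff.2 hm)

theorem isPGroup_zpowers {x : X} {k : ℕ} (hx : x ^ p ^ k = 1) :
    IsPGroup p (Subgroup.zpowers x) := by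
  rintro ⟨_, j, rfl⟩
  refine ⟨k, Subtype.ext ?_⟩
  change (x ^ j) ^ p ^ k = 1
  rw [← zpow_natCast, zpow_comm, zpow_natCast, hx, one_zpow]

theorem mulAutCongr_apply_apply {Y : Type*} [Group Y] (e : X ≃* Y) (u : MulAut X) (x : X) :
    MulAut.congr e u (e x) = e (u x) :=
  congrArg (fun y => e (u y)) (e.symm_apply_apply x)

/-- `T` is a Sylow `p`-subgroup of the subgroup `Γ`, where both are subgroups of an ambient
group. -/
def IsSylowIn (p : ℕ) (T Γ : Subgroup X) : Prop :=
  ∃ S : Sylow p Γ, (S : Subgroup Γ).map Γ.subtype = T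

namespace IsSylowIn

variable {T Γ H M : Subgroup X}

theorem le (h : IsSylowIn p T Γ) : T ≤ Γ := by
  obtain ⟨S, rfl⟩ := h
  exact Subgroup.map_subtype_le _

theorem isPGroup (h : IsSylowIn p T Γ) : IsPGroup p T := by
  obtain ⟨S, rfl⟩ := h
  exact S.2.map _

theorem exists_ge (hH : IsPGroup p H) (hHΓ : H ≤ Γ) : ∃ T, IsSylowIn p T Γ ∧ H ≤ T := by
  obtain ⟨S, hS⟩ :=
    (hH.comap_of_injective Γ.subtype Γ.subtype_injective).exists_le_sylow
  exact ⟨_, ⟨S, rfl⟩, fun x hx => ⟨⟨x, hHΓ hx⟩, hS hx, rfl⟩⟩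

theorem le_of_normal (h : IsSylowIn p T Γ) (hH : IsPGroup p H) (hHΓ : H ≤ Γ)
    (hΓ : Γ ≤ Subgroup.normalizer (H : Set X)) : H ≤ T := by
  obtain ⟨S, rfl⟩ := h
  have : (H.subgroupOf Γ).Normal := Subgroup.normal_subgroupOf_of_le_normalizer hΓ
  have hHp : IsPGroup p (H.subgroupOf Γ) :=
    hH.comap_of_injective Γ.subtype Γ.subtype_injective
  exact fun x hx => ⟨⟨x, hHΓ hx⟩, hHp.le_sylow_of_normal S hx, rfl⟩

variable [Fact p.Prime] [Finite X]

theorem exists_conj_le (h : IsSylowIn p T Γ) (hH : IsPGroup p H) (hHΓ : H ≤ Γ) :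
    ∃ g ∈ Γ, H.map (MulAut.conj g).toMonoidHom ≤ T := by
  obtain ⟨S, rfl⟩ := h
  obtain ⟨S', hHS'⟩ :=
    (hH.comap_of_injective Γ.subtype Γ.subtype_injective).exists_le_sylow
  obtain ⟨g, rfl⟩ := MulAction.exists_smul_eq Γ S' S
  refine ⟨g, g.2, ?_⟩
  rintro _ ⟨h, hh, rfl⟩
  exact ⟨g * ⟨h, hHΓ hh⟩ * g⁻¹, ⟨⟨h, hHΓ hh⟩, hHS' hh, rfl⟩, rfl⟩

theorem of_normalizer (hT : IsPGroup p T) (hTΓ : T ≤ Γ)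
    (h : ∀ u ∈ Γ, (∃ n : ℕ, u ^ p ^ n = 1) → u ∈ Subgroup.normalizer (T : Set X) → u ∈ T) :
    IsSylowIn p T Γ := by
  obtain ⟨S, hS, hTS⟩ := exists_ge hT hTΓ
  have := hS.isPGroup.isNilpotent
  obtain rfl | hlt := hTS.eq_or_lt
  · exact hS
  refine absurd (lt_inf_normalizer hlt) (not_lt_of_ge fun u hu => h u (hS.le hu.1) ?_ hu.2)
  obtain ⟨n, hn⟩ := hS.isPGroup ⟨u, hu.1⟩
  exact ⟨n, congrArg Subtype.val hn⟩

theorem inf_of_normal (h : IsSylowIn p T Γ) (hM : M ≤ Γ)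
    (hΓ : Γ ≤ Subgroup.normalizer (M : Set X)) : IsSylowIn p (T ⊓ M) M := by
  obtain ⟨S, hS, hTS⟩ := exists_ge (h.isPGroup.to_le inf_le_left) (inf_le_right : T ⊓ M ≤ M)
  obtain ⟨g, hg, hgS⟩ := h.exists_conj_le hS.isPGroup (hS.le.trans hM)
  have hSM : S.map (MulAut.conj g).toMonoidHom ≤ M := by
    rintro _ ⟨s, hs, rfl⟩
    exact (Subgroup.mem_normalizer_iff.1 (hΓ hg) s).1 (hS.le hs)
  have hcard : Nat.card S ≤ Nat.card ↥(T ⊓ M) := by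
    rw [← Subgroup.card_map_of_injective (f := (MulAut.conj g).toMonoidHom)
      (MulAut.conj g).injective]
    exact Subgroup.card_le_of_le (le_inf hgS hSM)
  rwa [Subgroup.eq_of_le_of_card_ge hTS hcard]

end IsSylowIn

/-- The group `Aut_N(A)` of the automorphisms of `A` induced by conjugation with elements of
`N` that normalize `A`. -/
noncomputable def conjAut (N A : Subgroup X) : Subgroup (MulAut A) :=
  (N.subgroupOf (Subgroup.normalizer (A : Set X))).map A.normalizerMonoidHom

section conjAut

variable {N M A B : Subgroup X}

theorem mem_conjAut {u : MulAut A} :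
    u ∈ conjAut N A ↔
      ∃ x ∈ N ⊓ Subgroup.normalizer (A : Set X), ∀ a : A, (u a : X) = x⁻¹ * a * x := by
  constructor
  · rintro ⟨x, hx, rfl⟩
    exact ⟨(x : X)⁻¹, inv_mem ⟨hx, x.2⟩, fun a => by simp⟩
  · rintro ⟨x, hx, h⟩
    refine ⟨⟨x⁻¹, Subgroup.inv_mem _ hx.2⟩, Subgroup.inv_mem _ hx.1, ?_⟩
    ext a
    simp [h]

theorem conjAut_mono (h : N ≤ M) : conjAut N A ≤ conjAut M A :=
  Subgroup.map_mono (Subgroup.comap_mono h)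

theorem exists_mem_conjAut {x : X} (hx : x ∈ N ⊓ Subgroup.normalizer (A : Set X)) :
    ∃ u ∈ conjAut N A, ∀ a : A, (u a : X) = x⁻¹ * a * x :=
  ⟨A.normalizerMonoidHom ⟨x⁻¹, Subgroup.inv_mem _ hx.2⟩,
    ⟨⟨x⁻¹, Subgroup.inv_mem _ hx.2⟩, Subgroup.inv_mem _ hx.1, rfl⟩, fun a => by simp⟩

theorem conjAut_self : conjAut A A = (MulAut.conj : A →* MulAut A).range := by
  ext u
  constructor
  · rw [mem_conjAut]
    rintro ⟨x, hx, h⟩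
    exact ⟨⟨x⁻¹, inv_mem hx.1⟩, by ext a; simp [h]⟩
  · rintro ⟨x, rfl⟩
    exact mem_conjAut.2 ⟨(x : X)⁻¹, inv_mem ⟨x.2, Subgroup.le_normalizer x.2⟩, fun a => by simp⟩

theorem isPGroup_conjAut (hN : IsPGroup p N) : IsPGroup p (conjAut N A) :=
  (hN.comap_of_injective (Subgroup.normalizer (A : Set X)).subtype
    (Subgroup.subtype_injective _)).map _

theorem IsSylowIn.exists_map_congr_trans_le [Fact p.Prime] [Finite B] {T Γ : Subgroup (MulAut B)}
    (hT : IsSylowIn p T Γ) (e : A ≃* B) {H : Subgroup (MulAut A)} (hH : IsPGroup p H)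
    (hHΓ : H.map (MulAut.congr e).toMonoidHom ≤ Γ) :
    ∃ γ ∈ Γ, H.map (MulAut.congr (e.trans γ)).toMonoidHom ≤ T := by
  obtain ⟨γ, hγ, hγT⟩ := hT.exists_conj_le (hH.map _) hHΓ
  refine ⟨γ, hγ, ?_⟩
  rwa [Subgroup.map_map] at hγT

end conjAut

/-- The group of the automorphisms that stabilize the chain `K`: they leave every `K i`
invariant and act trivially on the cosets of `K (i + 1)` in `K i`. The chain is meant to be
descending, but the definition does not ask for it. -/
def chainStabilizer (K : ℕ → Subgroup X) : Subgroup (MulAut X) where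
  carrier := {u | ∀ i, (∀ x, u x ∈ K i ↔ x ∈ K i) ∧ ∀ x ∈ K i, x⁻¹ * u x ∈ K (i + 1)}
  one_mem' i := ⟨fun _ => Iff.rfl, fun x _ => by simp⟩
  mul_mem' {u v} hu hv i := by
    refine ⟨fun x => ((hu i).1 _).trans ((hv i).1 x), fun x hx => ?_⟩
    have := mul_mem ((hv i).2 x hx) ((hu i).2 (v x) (((hv i).1 x).2 hx))
    rwa [mul_assoc, mul_inv_cancel_left] at this
  inv_mem' {u} hu i := by
    have hmem : ∀ x, u⁻¹ x ∈ K i ↔ x ∈ K i := fun x => by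
      rw [← (hu i).1, MulAut.apply_inv_self]
    refine ⟨hmem, fun x hx => ?_⟩
    have := inv_mem ((hu i).2 (u⁻¹ x) ((hmem x).2 hx))
    rwa [MulAut.apply_inv_self, mul_inv_rev, inv_inv] at this

section chainStabilizer

variable {Y : Type*} [Group Y] {K : ℕ → Subgroup X} {L : ℕ → Subgroup Y}

theorem congr_mem_chainStabilizer {e : X ≃* Y} (he : ∀ i x, e x ∈ L i ↔ x ∈ K i) {u : MulAut X}
    (hu : u ∈ chainStabilizer K) : MulAut.congr e u ∈ chainStabilizer L := by
  intro i
  refine ⟨e.surjective.forall.2 fun x => ?_, e.surjective.forall.2 fun x hx => ?_⟩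
  · rw [mulAutCongr_apply_apply, he, he, (hu i).1]
  · rw [mulAutCongr_apply_apply, ← map_inv, ← map_mul, he]
    exact (hu i).2 x ((he i x).1 hx)

theorem pow_apply_eq_mul_pow {u : MulAut X} {x : X}
    (h : u (x⁻¹ * u x) = x⁻¹ * u x) (j : ℕ) : (u ^ j) x = x * (x⁻¹ * u x) ^ j := by
  induction j with
  | zero => simp
  | succ j ih =>
    rw [pow_succ', MulAut.mul_apply, ih, map_mul, map_pow, h, pow_succ', ← mul_assoc x,
      mul_inv_cancel_left]

theorem isPGroup_chainStabilizer [Fact p.Prime] [Finite X] (hX : IsPGroup p X) (h0 : K 0 = ⊤)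
    {m : ℕ} (hm : K m = ⊥) : IsPGroup p (chainStabilizer K) := by
  obtain ⟨k, hk⟩ := IsPGroup.iff_card.1 hX
  have key : ∀ n, ∀ u ∈ chainStabilizer K, ∀ i, i + n = m → ∀ x ∈ K i, (u ^ p ^ (k * n)) x = x := by
    intro n u hu
    induction n with
    | zero =>
      rintro i rfl x hx
      rw [add_zero] at hm
      rw [hm, Subgroup.mem_bot] at hx
      rw [hx, map_one]
    | succ n ih =>
      intro i hi x hx
      have hfix := ih (i + 1) (by omega) _ ((pow_mem hu (p ^ (k * n)) i).2 x hx)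
      rw [mul_add, mul_one, pow_add, pow_mul, pow_apply_eq_mul_pow hfix, ← hk,
        pow_card_eq_one', mul_one]
  rintro ⟨u, hu⟩
  refine ⟨k * m, Subtype.ext (MulEquiv.ext fun x => ?_)⟩
  exact key m u hu 0 (zero_add m) x (h0 ▸ Subgroup.mem_top x)

end chainStabilizer

end GroupTheory

/-! ### Isomorphisms of a fusion system and strongly closed subgroups -/

namespace FusionSystem

variable {G : Type*} [Group G]

/-- The map `f` restricts to an isomorphism `A → B` that lies in the fusion system `F`. The values
of `f` outside `A` are irrelevant: maps on the ambient group are used because they can be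
restricted, extended and composed without changing their type. -/
def IsIso (F : FusionSystem G) (A B : Subgroup G) (f : G → G) : Prop :=
  ∃ e : A ≃* B, e.toMonoidHom ∈ F.Hom A B ∧ ∀ a : A, (e a : G) = f a

variable {F : FusionSystem G} {A B C N X Y : Subgroup G} {f g : G → G}

theorem exists_forall_coe_eq (φ : A →* B) : ∃ f : G → G, ∀ a : A, (φ a : G) = f a := by
  classical
  exact ⟨fun x => if hx : x ∈ A then φ ⟨x, hx⟩ else 1, fun a => by simp⟩

theorem exists_isIso_of_mem {φ : A →* B} (h : φ ∈ F.Hom A B) :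
    ∃ f : G → G, (∀ a : A, (φ a : G) = f a) ∧ F.IsIso A (imageSubgroup φ) f := by
  obtain ⟨f, hf⟩ := exists_forall_coe_eq φ
  have hbij : Function.Bijective (toImage φ) :=
    ⟨F.injective (F.toImage_mem h), fun ⟨_, a, rfl⟩ => ⟨a, rfl⟩⟩
  exact ⟨f, hf, MulEquiv.ofBijective _ hbij, F.toImage_mem h, hf⟩

theorem exists_isIso_of_equiv {e : A ≃* B} (he : e.toMonoidHom ∈ F.Hom A B) :
    ∃ f : G → G, (∀ a : A, (e a : G) = f a) ∧ F.IsIso A B f := by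
  obtain ⟨f, hf⟩ := exists_forall_coe_eq e.toMonoidHom
  exact ⟨f, hf, e, he, hf⟩

theorem inclusion_mem (hAB : A ≤ B) (hB : B ≤ F.carrier) : Subgroup.inclusion hAB ∈ F.Hom A B :=
  F.conj_mem (hAB.trans hB) hB 1 (one_mem _) _ fun a => by simp

namespace IsIso

theorem le_left (h : F.IsIso A B f) : A ≤ F.carrier := (F.le_carrier h.choose_spec.1).1

theorem le_right (h : F.IsIso A B f) : B ≤ F.carrier := (F.le_carrier h.choose_spec.1).2

theorem isConjugate (h : F.IsIso A B f) : F.IsConjugate A B := ⟨h.choose, h.choose_spec.1⟩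

theorem card_eq (h : F.IsIso A B f) : Nat.card A = Nat.card B :=
  Nat.card_congr h.choose.toEquiv

theorem congr (h : F.IsIso A B f) (hfg : Set.EqOn f g A) : F.IsIso A B g := by
  obtain ⟨e, he, hf⟩ := h
  exact ⟨e, he, fun a => (hf a).trans (hfg a.2)⟩

theorem bijOn (h : F.IsIso A B f) : Set.BijOn f A B := by
  obtain ⟨e, -, hf⟩ := h
  refine ⟨fun a ha => hf ⟨a, ha⟩ ▸ (e ⟨a, ha⟩).2, fun a ha b hb hab => ?_, fun b hb => ?_⟩
  · exact congrArg Subtype.val (e.injective (Subtype.ext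
      ((hf ⟨a, ha⟩).trans (hab.trans (hf ⟨b, hb⟩).symm))))
  · exact ⟨e.symm ⟨b, hb⟩, (e.symm ⟨b, hb⟩).2, by rw [← hf, MulEquiv.apply_symm_apply]⟩

theorem mapsTo (h : F.IsIso A B f) : Set.MapsTo f A B := h.bijOn.mapsTo

theorem map_one (h : F.IsIso A B f) : f 1 = 1 := by
  obtain ⟨e, -, hf⟩ := h
  simpa using (hf 1).symm

theorem map_conj (h : F.IsIso A B f) {x a : G} (hx : x ∈ A) (ha : a ∈ A) :
    f (x⁻¹ * a * x) = (f x)⁻¹ * f a * f x := by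
  obtain ⟨e, -, hf⟩ := h
  have := hf (⟨x, hx⟩⁻¹ * ⟨a, ha⟩ * ⟨x, hx⟩)
  simpa [hf] using this.symm

theorem unique (h : F.IsIso A B f) (h' : F.IsIso A C g) (hfg : Set.EqOn f g A) : B = C :=
  SetLike.coe_injective ((h.congr hfg).bijOn.image_eq.symm.trans h'.bijOn.image_eq)

theorem eq_of_le (h : F.IsIso A B f) [Finite A] (hBA : B ≤ A) : B = A :=
  Subgroup.eq_of_le_of_card_ge hBA h.card_eq.le

theorem refl (hA : A ≤ F.carrier) : F.IsIso A A id :=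
  ⟨MulEquiv.refl A, inclusion_mem le_rfl hA, fun _ => rfl⟩

theorem comp (h : F.IsIso A B f) (h' : F.IsIso B C g) : F.IsIso A C (g ∘ f) := by
  obtain ⟨e, he, hf⟩ := h
  obtain ⟨e', he', hg⟩ := h'
  refine ⟨e.trans e', F.comp_mem he he', fun a => ?_⟩
  rw [MulEquiv.trans_apply, hg, hf, Function.comp_apply]

theorem symm (h : F.IsIso A B f) : ∃ g, F.IsIso B A g ∧ Set.InvOn g f A B := by
  obtain ⟨e, he, hf⟩ := h
  obtain ⟨g, hg, hgi⟩ := exists_isIso_of_equiv (F.symm_mem e he)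
  refine ⟨g, hgi, fun a ha => ?_, fun b hb => ?_⟩
  · rw [← hf ⟨a, ha⟩, ← hg, MulEquiv.symm_apply_apply]
  · rw [← hg ⟨b, hb⟩, ← hf, MulEquiv.apply_symm_apply]

theorem hom_mem (h : F.IsIso A B f) (hBC : B ≤ C) (hC : C ≤ F.carrier) {φ : A →* C}
    (hφ : ∀ a : A, (φ a : G) = f a) : φ ∈ F.Hom A C := by
  obtain ⟨e, he, hf⟩ := h
  have hφe : φ = (Subgroup.inclusion hBC).comp e.toMonoidHom := by
    ext a
    exact (hφ a).trans (hf a).symm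
  exact hφe ▸ F.comp_mem he (inclusion_mem hBC hC)

theorem exists_hom (h : F.IsIso A B f) (hBC : B ≤ C) (hC : C ≤ F.carrier) :
    ∃ φ ∈ F.Hom A C, ∀ a : A, (φ a : G) = f a := by
  obtain ⟨e, he, hf⟩ := h
  exact ⟨_, F.comp_mem he (inclusion_mem hBC hC), hf⟩

theorem imageSubgroup_eq (h : F.IsIso A B f) {φ : A →* C} (hφ : ∀ a : A, (φ a : G) = f a) :
    imageSubgroup φ = B := by
  refine SetLike.coe_injective ?_
  rw [← h.bijOn.image_eq]
  ext b
  exact ⟨fun ⟨a, ha⟩ => ⟨a, a.2, (hφ a).symm.trans ha⟩,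
    fun ⟨a, ha, hb⟩ => ⟨⟨a, ha⟩, (hφ _).trans hb⟩⟩

theorem restrict (h : F.IsIso A B f) (hX : X ≤ A) : ∃ Y ≤ B, F.IsIso X Y f := by
  obtain ⟨φ, hφ, hf⟩ := h.exists_hom le_rfl h.le_right
  obtain ⟨g, hg, hi⟩ := exists_isIso_of_mem (F.comp_mem (inclusion_mem hX h.le_left) hφ)
  have hfX := hi.congr fun a ha => (hg ⟨a, ha⟩).symm.trans (hf ⟨a, hX ha⟩)
  refine ⟨_, fun b hb => ?_, hfX⟩
  obtain ⟨a, ha, rfl⟩ := hfX.bijOn.surjOn hb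
  exact h.mapsTo (hX ha)

theorem restrict_eq (h : F.IsIso A B f) (hX : X ≤ A) (hY : f '' X = (Y : Set G)) :
    F.IsIso X Y f := by
  obtain ⟨Y', -, h'⟩ := h.restrict hX
  rwa [show Y = Y' from SetLike.coe_injective (hY.symm.trans h'.bijOn.image_eq)]

theorem restrict_symm (h : F.IsIso A B f) (hgf : Set.InvOn g f A B) (hX : X ≤ A)
    (hXY : F.IsIso X Y f) (hg : F.IsIso B A g) : F.IsIso Y X g := by
  have hY : Y ≤ B := fun b hb => by
    obtain ⟨a, ha, rfl⟩ := hXY.bijOn.surjOn hb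
    exact h.mapsTo (hX ha)
  refine hg.restrict_eq hY ?_
  rw [← hXY.bijOn.image_eq, (hgf.1.mono hX).image_image]

theorem sup (h : F.IsIso A B f) {X' Y' : Subgroup G} (hX : X ≤ A) (hY : Y ≤ A)
    (hX' : F.IsIso X X' f) (hY' : F.IsIso Y Y' f) : F.IsIso (X ⊔ Y) (X' ⊔ Y') f := by
  obtain ⟨φ, -, hf⟩ := h.exists_hom le_rfl h.le_right
  have himage : ∀ Z ≤ A, f '' Z = ((Z.subgroupOf A).map (B.subtype.comp φ) : Subgroup G) := by
    intro Z hZ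
    ext b
    constructor
    · rintro ⟨a, ha, rfl⟩
      exact ⟨⟨a, hZ ha⟩, ha, hf ⟨a, hZ ha⟩⟩
    · rintro ⟨a, ha, rfl⟩
      exact ⟨a, ha, (hf a).symm⟩
  refine h.restrict_eq (sup_le hX hY) ?_
  rw [himage _ (sup_le hX hY), Subgroup.subgroupOf_sup hX hY, Subgroup.map_sup,
    SetLike.coe_injective ((himage X hX).symm.trans hX'.bijOn.image_eq),
    SetLike.coe_injective ((himage Y hY).symm.trans hY'.bijOn.image_eq)]

theorem mem_normalizerIn [Finite A] (hg : F.IsIso N C g) (hAN : A ≤ N) (hA : F.IsIso A B g)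
    {x : G} (hx : x ∈ N) (hxA : x ∈ Subgroup.normalizer (A : Set G)) :
    g x ∈ F.normalizerIn B := by
  have : Finite B := Finite.of_equiv _ hA.choose.toEquiv
  refine ⟨hg.le_right (hg.mapsTo hx), mem_normalizer_of_forall_conj_mem fun b hb => ?_⟩
  obtain ⟨a, ha, rfl⟩ := hA.bijOn.surjOn hb
  rw [← hg.map_conj hx (hAN ha)]
  exact hA.mapsTo ((Subgroup.mem_normalizer_iff''.1 hxA a).1 ha)

end IsIso

theorem isConjugate_iff : F.IsConjugate A B ↔ ∃ f, F.IsIso A B f :=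
  ⟨fun ⟨_, he⟩ => let ⟨f, _, hf⟩ := exists_isIso_of_equiv he; ⟨f, hf⟩,
    fun ⟨_, hf⟩ => hf.isConjugate⟩

theorem isIso_conj {x : G} (hx : x ∈ F.carrier) :
    F.IsIso F.carrier F.carrier fun a => x⁻¹ * a * x := by
  let e : MulAut F.carrier := MulAut.conj (⟨x, hx⟩⁻¹)
  have he : ∀ a : F.carrier, (e a : G) = x⁻¹ * a * x := fun a => by simp [e]
  exact ⟨e, F.conj_mem le_rfl le_rfl x hx _ he, he⟩

theorem conjAut_le_aut (hA : A ≤ F.carrier) : conjAut F.carrier A ≤ F.aut A hA := by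
  intro u hu
  obtain ⟨x, hx, hux⟩ := mem_conjAut.1 hu
  exact F.conj_mem hA hA x hx.1 _ hux

theorem congr_mem_aut {e : A ≃* B} (he : e.toMonoidHom ∈ F.Hom A B) {u : MulAut A}
    (hu : u ∈ F.aut A (F.le_carrier he).1) : MulAut.congr e u ∈ F.aut B (F.le_carrier he).2 :=
  F.comp_mem (F.symm_mem e he) (F.comp_mem hu he)

theorem isStronglyClosed_iff :
    F.IsStronglyClosed Y ↔ Y ≤ F.carrier ∧ ∀ A B f, F.IsIso A B f → A ≤ Y → B ≤ Y := by
  refine and_congr_right fun _ => ⟨fun h A B f hf hA => ?_, fun h A B φ hφ hA => ?_⟩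
  · obtain ⟨φ, hφ, hφf⟩ := hf.exists_hom le_rfl hf.le_right
    exact hf.imageSubgroup_eq hφf ▸ h A B φ hφ hA
  · obtain ⟨f, -, hf⟩ := exists_isIso_of_mem hφ
    exact h _ _ f hf hA

theorem isStronglyClosed_carrier : F.IsStronglyClosed F.carrier :=
  isStronglyClosed_iff.2 ⟨le_rfl, fun _ _ _ hf _ => hf.le_right⟩

end FusionSystem

namespace PrefusionSystem.IsStronglyClosed

open FusionSystem

variable {G : Type*} [Group G] {F : FusionSystem G} {A B C S : Subgroup G} {f g : G → G}

theorem mem (hS : F.IsStronglyClosed S) (hf : F.IsIso A B f) {a : G} (ha : a ∈ A) (haS : a ∈ S) :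
    f a ∈ S := by
  obtain ⟨Y, -, h⟩ := hf.restrict (inf_le_left : A ⊓ S ≤ A)
  exact (isStronglyClosed_iff.1 hS).2 _ _ _ h inf_le_right (h.mapsTo ⟨ha, haS⟩)

theorem mem_iff (hS : F.IsStronglyClosed S) (hf : F.IsIso A B f) {a : G} (ha : a ∈ A) :
    f a ∈ S ↔ a ∈ S := by
  obtain ⟨g, hg, hgf⟩ := hf.symm
  exact ⟨fun h => hgf.1 ha ▸ hS.mem hg (hf.mapsTo ha) h, hS.mem hf ha⟩

theorem le_normalizer (hS : F.IsStronglyClosed S) :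
    F.carrier ≤ Subgroup.normalizer (S : Set G) :=
  Subgroup.le_normalizer_iff.2 fun x hx a ha => by
    simpa using hS.mem (isIso_conj (inv_mem hx)) (hS.1 ha) ha

theorem isIso_sup [Finite S] (hS : F.IsStronglyClosed S) (hf : F.IsIso A B f)
    (hg : F.IsIso (S ⊔ A) C g) (hfg : Set.EqOn g f A) :
    F.IsIso S S g ∧ F.IsIso (S ⊔ A) (S ⊔ B) g := by
  obtain ⟨S', -, hS'⟩ := hg.restrict (le_sup_left : S ≤ S ⊔ A)
  obtain rfl := hS'.eq_of_le ((isStronglyClosed_iff.1 hS).2 _ _ _ hS' le_rfl)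
  exact ⟨hS', hg.sup le_sup_left le_sup_right hS' (hf.congr hfg.symm)⟩

end PrefusionSystem.IsStronglyClosed

/-! ### Automizers of fully normalized subgroups -/

namespace FusionSystem

variable {G : Type*} [Group G] {p : ℕ} {F : FusionSystem G} {A B N : Subgroup G} {f : G → G}

theorem IsSaturated.exists_extension (hF : F.IsSaturated p) {e : A ≃* B}
    (he : e.toMonoidHom ∈ F.Hom A B) (hB : F.IsFullyNormalized B) (hN : N ≤ F.normalizerIn A)
    (h : (conjAut N A).map (MulAut.congr e).toMonoidHom ≤ conjAut F.carrier B) :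
    ∃ g C, F.IsIso (A ⊔ N) C g ∧ ∀ a : A, g a = e a := by
  obtain ⟨f, hef, hf⟩ := exists_isIso_of_equiv he
  obtain ⟨φ, hφ, hφf⟩ := hf.exists_hom hf.le_right le_rfl
  have himage : imageSubgroup φ = B := hf.imageSubgroup_eq hφf
  obtain ⟨φ', hφ', hext⟩ := hF.extension A φ hφ (himage ▸ hB)
  have hAφ : A ≤ F.extensionGroup φ := fun x hx =>
    ⟨⟨hf.le_left hx, Subgroup.le_normalizer hx⟩, f x, himage ▸ ⟨hf.le_right (hf.mapsTo hx),
      Subgroup.le_normalizer (hf.mapsTo hx)⟩, fun a b hab => by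
        rw [hφf, hφf, hab, hf.map_conj hx a.2]⟩
  have hNφ : N ≤ F.extensionGroup φ := fun x hx => by
    obtain ⟨u, hu, hux⟩ := exists_mem_conjAut ⟨hx, (hN hx).2⟩
    obtain ⟨y, hy, huy⟩ := mem_conjAut.1 (h ⟨u, hu, rfl⟩)
    refine ⟨hN hx, y, himage ▸ hy, fun a b hab => ?_⟩
    obtain rfl : b = u a := Subtype.ext (hab.trans (hux a).symm)
    rw [hφf, hφf, ← hef, ← hef, ← huy]
    exact congrArg Subtype.val (mulAutCongr_apply_apply e u a).symm
  obtain ⟨g, hg, hgi⟩ := exists_isIso_of_mem hφ'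
  obtain ⟨C, -, hC⟩ := hgi.restrict (sup_le hAφ hNφ)
  refine ⟨g, C, hC, fun a => ?_⟩
  rw [hef, ← hφf, ← hext a a.2 (hAφ a.2), hg]

theorem normalizerIn_le (A : Subgroup G) : F.normalizerIn A ≤ F.carrier := inf_le_left

theorem le_normalizerIn (hA : A ≤ F.carrier) : A ≤ F.normalizerIn A :=
  le_inf hA Subgroup.le_normalizer

theorem exists_isFullyNormalized [Finite F.carrier] (hA : A ≤ F.carrier) :
    ∃ B f, F.IsIso A B f ∧ F.IsFullyNormalized B := by
  let orders : Set ℕ := {n | ∃ B f, F.IsIso A B f ∧ Nat.card (F.normalizerIn B) = n}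
  have hne : orders.Nonempty := ⟨_, A, id, IsIso.refl hA, rfl⟩
  have hbdd : BddAbove orders := by
    refine ⟨Nat.card F.carrier, ?_⟩
    rintro _ ⟨B, -, -, rfl⟩
    exact Subgroup.card_le_of_le (normalizerIn_le B)
  obtain ⟨B, f, hf, hB⟩ := Nat.sSup_mem hne hbdd
  refine ⟨B, f, hf, fun C hC => hB ▸ le_csSup hbdd ?_⟩
  obtain ⟨g, hg⟩ := isConjugate_iff.1 hC
  exact ⟨C, g ∘ f, hf.comp hg, rfl⟩

theorem normalizerIn_eq_of_isIso [Finite F.carrier] (hA : F.IsFullyNormalized A)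
    (hf : F.IsIso (F.normalizerIn A) N f) (hAB : F.IsIso A B f) : N = F.normalizerIn B := by
  have : Finite A := finite_of_le hAB.le_left
  have : Finite (F.normalizerIn B) := finite_of_le (normalizerIn_le _)
  refine Subgroup.eq_of_le_of_card_ge (fun b hb => ?_)
    ((hA B hAB.isConjugate).trans hf.card_eq.le)
  obtain ⟨x, hx, rfl⟩ := hf.bijOn.surjOn hb
  exact hf.mem_normalizerIn (le_normalizerIn hAB.le_left) hAB hx hx.2

theorem exists_equiv_map_congr_le [Fact p.Prime] [Finite B] {e : A ≃* B}
    (he : e.toMonoidHom ∈ F.Hom A B)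
    (hB : IsSylowIn p (conjAut F.carrier B) (F.aut B (F.le_carrier he).2))
    {H : Subgroup (MulAut A)} (hH : IsPGroup p H) (hHF : H ≤ F.aut A (F.le_carrier he).1) :
    ∃ e' : A ≃* B, e'.toMonoidHom ∈ F.Hom A B ∧
      H.map (MulAut.congr e').toMonoidHom ≤ conjAut F.carrier B := by
  obtain ⟨γ, hγ, hγH⟩ := hB.exists_map_congr_trans_le e hH
    (Subgroup.map_le_iff_le_comap.2 fun u hu => congr_mem_aut he (hHF hu))
  exact ⟨e.trans γ, F.comp_mem he hγ, hγH⟩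

theorem IsSaturated.exists_extension_normalizerIn [Finite F.carrier] (hF : F.IsSaturated p)
    (hA : A ≤ F.carrier) (hfn : F.IsFullyNormalized A) {u : MulAut A} (hu : u ∈ F.aut A hA)
    (hun : u ∈ Subgroup.normalizer (conjAut F.carrier A : Set (MulAut A))) :
    ∃ v ∈ F.aut (F.normalizerIn A) (normalizerIn_le A),
      ∀ a : A, v (Subgroup.inclusion (le_normalizerIn hA) a) =
        Subgroup.inclusion (le_normalizerIn hA) (u a) := by
  have : Finite (F.normalizerIn A) := finite_of_le (normalizerIn_le _)
  have : Finite A := finite_of_le hA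
  obtain ⟨g, C, hg, hgu⟩ := hF.exists_extension (e := u) hu hfn le_rfl (by
    rintro _ ⟨c, hc, rfl⟩
    exact (Subgroup.mem_normalizer_iff.1 hun c).1 (conjAut_mono inf_le_left hc))
  rw [sup_eq_right.2 (le_normalizerIn hA)] at hg
  have hgA : F.IsIso A A g := ⟨u, hu, fun a => (hgu a).symm⟩
  obtain rfl : C = F.normalizerIn A := hg.eq_of_le fun b hb => by
    obtain ⟨x, hx, rfl⟩ := hg.bijOn.surjOn hb
    exact hg.mem_normalizerIn (le_normalizerIn hA) hgA hx hx.2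
  obtain ⟨v, hv, hvg⟩ := hg
  exact ⟨v, hv, fun a => Subtype.ext ((hvg _).trans (hgu a))⟩

theorem mem_conjAut_of_extension [Fact p.Prime] [Finite F.carrier] (hA : A ≤ F.carrier)
    (hfn : F.IsFullyNormalized A)
    (hN : ∀ B (hB : B ≤ F.carrier), F.IsConjugate (F.normalizerIn A) B → F.IsFullyNormalized B →
      IsSylowIn p (conjAut F.carrier B) (F.aut B hB))
    {v : MulAut (F.normalizerIn A)} (hv : v ∈ F.aut _ (normalizerIn_le A)) {k : ℕ}
    (hvp : v ^ p ^ k = 1)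
    {w : MulAut A} (hvw : ∀ a : A, v (Subgroup.inclusion (le_normalizerIn hA) a) =
      Subgroup.inclusion (le_normalizerIn hA) (w a)) :
    w ∈ conjAut F.carrier A := by
  obtain ⟨B, f, hf, hB⟩ := exists_isFullyNormalized (normalizerIn_le (F := F) A)
  have : Finite B := finite_of_le hf.le_right
  obtain ⟨e, he⟩ := hf.isConjugate
  obtain ⟨e', he', hve'⟩ := exists_equiv_map_congr_le he (hN B hf.le_right ⟨e, he⟩ hB)
    (isPGroup_zpowers hvp) (Subgroup.zpowers_le.2 hv)
  obtain ⟨y, hy, hvy⟩ := mem_conjAut.1 (hve' ⟨v, Subgroup.mem_zpowers v, rfl⟩)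
  obtain ⟨s, hes, hs⟩ := exists_isIso_of_equiv he'
  obtain ⟨A', -, hA'⟩ := hs.restrict (le_normalizerIn hA)
  have : Finite A' := finite_of_le hA'.le_right
  have hwy : ∀ a : A, s (w a) = y⁻¹ * s a * y := fun a => by
    let ι := Subgroup.inclusion (le_normalizerIn hA)
    have ha : (MulAut.congr e' v (e' (ι a)) : G) = y⁻¹ * e' (ι a) * y := hvy _
    rw [mulAutCongr_apply_apply, hvw, hes, hes] at ha
    exact ha
  have hyA' : y ∈ F.normalizerIn A' := by
    refine ⟨hy.1, mem_normalizer_of_forall_conj_mem fun b hb => ?_⟩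
    obtain ⟨a, ha, rfl⟩ := hA'.bijOn.surjOn hb
    exact hwy ⟨a, ha⟩ ▸ hA'.mapsTo (w ⟨a, ha⟩).2
  obtain ⟨x, hx, rfl⟩ := hs.bijOn.surjOn (normalizerIn_eq_of_isIso hfn hs hA' ▸ hyA')
  refine mem_conjAut.2 ⟨x, hx, fun a => ?_⟩
  have haN := le_normalizerIn hA a.2
  refine hs.bijOn.injOn (le_normalizerIn hA (w a).2) (mul_mem (mul_mem (inv_mem hx) haN) hx) ?_
  rw [hwy, hs.map_conj hx haN]

theorem isSylowIn_conjAut [Fact p.Prime] [Finite F.carrier] (hP : IsPGroup p F.carrier)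
    (hF : F.IsSaturated p) (hA : A ≤ F.carrier) (hfn : F.IsFullyNormalized A) :
    IsSylowIn p (conjAut F.carrier A) (F.aut A hA) := by
  refine induction_on_larger_card (motive := fun A => ∀ hA : A ≤ F.carrier,
    F.IsFullyNormalized A → IsSylowIn p (conjAut F.carrier A) (F.aut A hA))
    (fun A _ ih hA hfn => ?_) hA hA hfn
  obtain rfl | hlt := hA.eq_or_lt
  · exact conjAut_self (A := F.carrier) ▸ hF.sylow
  have : Finite A := finite_of_le hA
  have := hP.isNilpotent
  have : Finite (F.normalizerIn A) := finite_of_le (normalizerIn_le A)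
  refine IsSylowIn.of_normalizer (isPGroup_conjAut hP) (conjAut_le_aut hA)
    fun u hu ⟨n, hun⟩ huN => ?_
  obtain ⟨v, hv, hvu⟩ := hF.exists_extension_normalizerIn hA hfn hu huN
  -- Only `v ^ m` has `p`-power order, but this suffices, as `m` is prime to the order of `u`.
  obtain ⟨k, m, hpm, hkm⟩ := Nat.exists_eq_pow_mul_and_not_dvd
    (orderOf_pos v).ne' p (Fact.out : p.Prime).ne_one
  have hvum (j : ℕ) (a : A) : (v ^ j) (Subgroup.inclusion (le_normalizerIn hA) a) =
      Subgroup.inclusion (le_normalizerIn hA) ((u ^ j) a) := by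
    induction j with
    | zero => rfl
    | succ j ih => rw [pow_succ', pow_succ', MulAut.mul_apply, MulAut.mul_apply, ih, hvu]
  have hm : m.Coprime (orderOf u) :=
    Nat.Coprime.of_dvd_right (orderOf_dvd_of_pow_eq_one hun)
      (((Nat.Prime.coprime_iff_not_dvd Fact.out).2 hpm).pow_left n).symm
  refine mem_of_pow_mem hm (mem_conjAut_of_extension (p := p) hA hfn (fun B hB hNB hBfn => ?_)
    (pow_mem hv m) (k := k) ?_ (hvum m))
  · refine ih B hB ?_ hB hBfn
    rw [← Nat.card_congr hNB.choose.toEquiv]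
    exact card_lt_card_of_lt (lt_inf_normalizer hlt)
  · rw [← pow_mul, mul_comm, ← hkm, pow_orderOf_eq_one]

end FusionSystem

/-! ### The Frattini factorization for invariant subsystems -/

namespace FusionSystem

variable {G : Type*} [Group G] {p : ℕ} {E F : FusionSystem G} {A A' B C : Subgroup G}
  {f g h : G → G}

theorem IsSubsystem.isIso (hEF : IsSubsystem E F) (hf : E.IsIso A B f) : F.IsIso A B f :=
  let ⟨e, he, hef⟩ := hf
  ⟨e, hEF.2 _ _ he, hef⟩

/-- `E` is an `F`-invariant subsystem of `F` on a strongly `F`-closed subgroup. Normal subsystems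
are the saturated ones among these. -/
structure IsInvariantSubsystem (E F : FusionSystem G) : Prop where
  isSubsystem : IsSubsystem E F
  isStronglyClosed : F.IsStronglyClosed E.carrier
  invariant : ∀ (A B : Subgroup G) (hAB : A ≤ B), B ≤ E.carrier →
    ∀ φ ∈ E.Hom A B, ∀ ψ ∈ F.Hom B F.carrier,
    ∃ χ ∈ E.Hom (imageSubgroup (ψ.comp (Subgroup.inclusion hAB))) E.carrier,
      ∀ a : A, (χ (toImage (ψ.comp (Subgroup.inclusion hAB)) a) : G) = ψ (φ a)

theorem IsNormalSubsystem.isInvariantSubsystem (hE : IsNormalSubsystem p E F) :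
    IsInvariantSubsystem E F :=
  ⟨hE.isSubsystem, hE.isStronglyClosed, hE.invariant⟩

/-- The map `f` restricts to an isomorphism `A → B` that is the composite of the restriction of an
automorphism of `E.carrier` in `F` with an isomorphism in `E`, as in the Frattini argument. -/
def HasFrattiniFactorization (E F : FusionSystem G) (A B : Subgroup G) (f : G → G) : Prop :=
  ∃ α β A', F.IsIso E.carrier E.carrier α ∧ F.IsIso A A' α ∧ E.IsIso A' B β ∧
    Set.EqOn (β ∘ α) f A

namespace IsInvariantSubsystem

theorem le_of_isIso (hE : IsInvariantSubsystem E F) (hf : F.IsIso A B f) (hA : A ≤ E.carrier) :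
    B ≤ E.carrier :=
  (isStronglyClosed_iff.1 hE.isStronglyClosed).2 _ _ _ hf hA

theorem conj_isIso (hE : IsInvariantSubsystem E F) (hf : E.IsIso A A' f) (hg : F.IsIso B C g)
    (hB : B ≤ E.carrier) (hA : A ≤ B) (hA' : A' ≤ B) {A₁ A₁' : Subgroup G}
    (hgA : F.IsIso A A₁ g) (hgA' : F.IsIso A' A₁' g) (hhg : Set.EqOn (h ∘ g) (g ∘ f) A) :
    E.IsIso A₁ A₁' h := by
  obtain ⟨φ, hφ, hφf⟩ := hf.exists_hom hA' hB
  obtain ⟨ψ, hψ, hψg⟩ := hg.exists_hom hg.le_right le_rfl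
  obtain ⟨χ, hχ, hχψ⟩ := hE.invariant A B hA hB φ hφ ψ hψ
  obtain ⟨k, hχk, hk⟩ := exists_isIso_of_mem hχ
  have hkg : Set.EqOn (k ∘ g) (g ∘ f) A := fun a ha => by
    have := hχψ ⟨a, ha⟩
    rw [hχk, hψg, hφf] at this
    rw [Function.comp_apply, Function.comp_apply, ← this]
    exact congrArg k (hψg (Subgroup.inclusion hA ⟨a, ha⟩)).symm
  generalize imageSubgroup χ = D at hk
  rw [hgA.imageSubgroup_eq fun a => hψg _] at hk
  have hkh : Set.EqOn k h A₁ := fun b hb => by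
    obtain ⟨a, ha, rfl⟩ := hgA.bijOn.surjOn hb
    exact (hkg ha).trans (hhg ha).symm
  refine (hk.congr hkh).restrict_eq le_rfl ?_
  rw [← hgA.bijOn.image_eq, ← hgA'.bijOn.image_eq, ← hf.bijOn.image_eq, ← Set.image_comp,
    ← Set.image_comp, hhg.image_eq]

theorem congr_mem_aut (hE : IsInvariantSubsystem E F) {e : A ≃* B}
    (he : e.toMonoidHom ∈ F.Hom A B) (hA : A ≤ E.carrier) (hB : B ≤ E.carrier) {u : MulAut A}
    (hu : u ∈ E.aut A hA) : MulAut.congr e u ∈ E.aut B hB := by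
  obtain ⟨f, hef, hf⟩ := exists_isIso_of_equiv he
  obtain ⟨k, huk, hk⟩ := exists_isIso_of_equiv hu
  obtain ⟨h, heh⟩ := exists_forall_coe_eq (MulAut.congr e u).toMonoidHom
  have heh' (b : B) : (MulAut.congr e u b : G) = h b := heh b
  refine (hE.conj_isIso hk hf hA le_rfl le_rfl hf hf fun a ha => ?_).hom_mem le_rfl hB heh
  lift a to A using ha
  rw [Function.comp_apply, Function.comp_apply, ← huk, ← hef, ← hef, ← heh',
    mulAutCongr_apply_apply]

theorem aut_le_normalizer (hE : IsInvariantSubsystem E F) (hA : A ≤ E.carrier)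
    (hAF : A ≤ F.carrier) : F.aut A hAF ≤ Subgroup.normalizer (E.aut A hA : Set (MulAut A)) :=
  Subgroup.le_normalizer_iff.2 fun _ hγ _ hu => hE.congr_mem_aut hγ hA hA hu

theorem hasFrattiniFactorization_of_comp (hE : IsInvariantSubsystem E F) (hA : A ≤ E.carrier)
    (hf : F.IsIso A B f) (hgf : HasFrattiniFactorization E F A C (g ∘ f))
    (hg : HasFrattiniFactorization E F B C g) : HasFrattiniFactorization E F A B f := by
  obtain ⟨α₁, β₁, A₁, hα₁, hAα₁, hβ₁, hβα₁⟩ := hgf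
  obtain ⟨α₂, β₂, B₂, hα₂, hBα₂, hβ₂, hβα₂⟩ := hg
  obtain ⟨σ, hσ, hσα₂⟩ := hα₂.symm
  obtain ⟨δ, hδ, hδβ₂⟩ := hβ₂.symm
  have hB := hE.le_of_isIso hf hA
  have hA₁ := hβ₁.le_left
  obtain ⟨A₃, -, hAσ⟩ := hσ.restrict hA₁
  have hBσ : F.IsIso B₂ B σ := hα₂.restrict_symm hσα₂ hB hBα₂ hσ
  refine ⟨σ ∘ α₁, σ ∘ δ ∘ β₁ ∘ α₂, A₃, hα₁.comp hσ, hAα₁.comp hAσ,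
    hE.conj_isIso (hβ₁.comp hδ) hσ le_rfl hA₁ hβ₂.le_left hAσ hBσ fun a ha => ?_, fun a ha => ?_⟩
  · exact congrArg (σ ∘ δ ∘ β₁) (hσα₂.2 (hA₁ ha))
  · have hfa := hf.mapsTo ha
    calc σ (δ (β₁ (α₂ (σ (α₁ a))))) = σ (δ (β₁ (α₁ a))) :=
          congrArg (σ ∘ δ ∘ β₁) (hσα₂.2 (hα₁.mapsTo (hA ha)))
      _ = σ (δ (β₂ (α₂ (f a)))) := congrArg (σ ∘ δ) ((hβα₁ ha).trans (hβα₂ hfa).symm)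
      _ = σ (α₂ (f a)) := congrArg σ (hδβ₂.1 (hBα₂.mapsTo hfa))
      _ = f a := hσα₂.1 (hB hfa)

variable [Fact p.Prime] [Finite F.carrier]

theorem exists_extension_normalizerIn (hE : IsInvariantSubsystem E F) (hP : IsPGroup p F.carrier)
    (hF : F.IsSaturated p) (hA : A ≤ E.carrier) (hf : F.IsIso A C f) (hC : F.IsFullyNormalized C) :
    ∃ k g D, E.IsIso C C k ∧ F.IsIso (E.normalizerIn A) D g ∧ Set.EqOn g (k ∘ f) A := by
  have hCE := hE.le_of_isIso hf hA
  have : Finite C := finite_of_le hf.le_right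
  obtain ⟨e, he, hef⟩ := id hf
  have hsylow : IsSylowIn p (conjAut F.carrier C ⊓ E.aut C hCE) (E.aut C hCE) :=
    (isSylowIn_conjAut hP hF hf.le_right hC).inf_of_normal (fun u hu => hE.isSubsystem.2 _ _ hu)
      (hE.aut_le_normalizer hCE hf.le_right)
  obtain ⟨γ, hγ, hγA⟩ := hsylow.exists_map_congr_trans_le e
    (isPGroup_conjAut (hP.to_le hE.isSubsystem.1) : IsPGroup p (conjAut E.carrier A))
    (Subgroup.map_le_iff_le_comap.2 fun u hu =>
      hE.congr_mem_aut he hA hCE (conjAut_le_aut hA hu))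
  obtain ⟨k, hγk, hk⟩ := exists_isIso_of_equiv hγ
  obtain ⟨g, D, hg, hge⟩ := hF.exists_extension (e := e.trans γ) (N := E.normalizerIn A)
    (F.comp_mem he (hE.isSubsystem.2 _ _ hγ)) hC (inf_le_inf_right _ hE.isSubsystem.1)
    ((Subgroup.map_mono (conjAut_mono (normalizerIn_le A))).trans (hγA.trans inf_le_left))
  rw [sup_eq_right.2 (le_normalizerIn hA)] at hg
  refine ⟨k, g, D, hk, hg, fun a ha => ?_⟩
  lift a to A using ha
  rw [hge, MulEquiv.trans_apply, hγk, hef, Function.comp_apply]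

theorem hasFrattiniFactorization_of_isFullyNormalized (hE : IsInvariantSubsystem E F)
    (hP : IsPGroup p F.carrier) (hF : F.IsSaturated p) (hA : A < E.carrier)
    (hf : F.IsIso A C f) (hC : F.IsFullyNormalized C)
    (ih : ∀ N ≤ E.carrier, Nat.card A < Nat.card N → ∀ D k, F.IsIso N D k →
      HasFrattiniFactorization E F N D k) : HasFrattiniFactorization E F A C f := by
  have : Finite E.carrier := finite_of_le hE.isSubsystem.1
  have : Finite (E.normalizerIn A) := finite_of_le (normalizerIn_le A)
  have := (hP.to_le hE.isSubsystem.1).isNilpotent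
  obtain ⟨k, g, D, hk, hg, hgk⟩ := hE.exists_extension_normalizerIn hP hF hA.le hf hC
  obtain ⟨α, β, N', hα, hNα, hβ, hβα⟩ :=
    ih _ (normalizerIn_le A) (card_lt_card_of_lt (lt_inf_normalizer hA)) D g hg
  have hAN := le_normalizerIn hA.le
  obtain ⟨A', hA', hAα⟩ := hNα.restrict hAN
  obtain ⟨C', -, hβA⟩ := hβ.restrict hA'
  have hβk : Set.EqOn (β ∘ α) (k ∘ f) A := (hβα.mono hAN).trans hgk
  obtain rfl : C' = C := (hAα.comp (hE.isSubsystem.isIso hβA)).unique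
    (hf.comp (hE.isSubsystem.isIso hk)) hβk
  obtain ⟨l, hl, hlk⟩ := hk.symm
  exact ⟨α, l ∘ β, A', hα, hAα, hβA.comp hl, fun a ha =>
    (congrArg l (hβk ha)).trans (hlk.1 (hf.mapsTo ha))⟩

theorem hasFrattiniFactorization (hE : IsInvariantSubsystem E F) (hP : IsPGroup p F.carrier)
    (hF : F.IsSaturated p) (hA : A ≤ E.carrier) (hf : F.IsIso A B f) :
    HasFrattiniFactorization E F A B f := by
  have : Finite E.carrier := finite_of_le hE.isSubsystem.1
  refine induction_on_larger_card (motive := fun A => ∀ B f, F.IsIso A B f →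
    HasFrattiniFactorization E F A B f) (fun A hA ih B f hf => ?_) hA B f hf
  have hB := hE.le_of_isIso hf hA
  obtain rfl | hlt := hA.eq_or_lt
  · obtain rfl := hf.eq_of_le hB
    exact ⟨f, id, _, hf, hf, IsIso.refl le_rfl, fun _ _ => rfl⟩
  have hBlt : B < E.carrier := lt_of_le_of_ne hB fun h =>
    (card_lt_card_of_lt hlt).ne (h ▸ hf.card_eq)
  obtain ⟨C, g, hg, hC⟩ := exists_isFullyNormalized hf.le_right
  exact hE.hasFrattiniFactorization_of_comp hA hf
    (hE.hasFrattiniFactorization_of_isFullyNormalized hP hF hlt (hf.comp hg) hC ih)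
    (hE.hasFrattiniFactorization_of_isFullyNormalized hP hF hBlt hg hC (hf.card_eq ▸ ih))

end IsInvariantSubsystem

end FusionSystem

/-! ### Normal subgroups of fusion systems -/

namespace FusionSystem

variable {G : Type*} [Group G] {p : ℕ} {E F : FusionSystem G} {A A' B B' R S : Subgroup G}
  {f g k : G → G}

/-- `R` is normal in the fusion system `F`: every isomorphism `A → B` of `F` extends to an
isomorphism `RA → RB` of `F` that restricts to an automorphism of `R`. -/
def IsNormalIn (F : FusionSystem G) (R : Subgroup G) : Prop :=
  ∀ A B f, F.IsIso A B f → ∃ g, F.IsIso (R ⊔ A) (R ⊔ B) g ∧ F.IsIso R R g ∧ Set.EqOn g f A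

theorem isIso_of_exists_mulAut (hg : F.IsIso A B g) (hR : R ≤ A) {κ : MulAut R}
    (hκ : ∀ r : R, (κ r : G) = g r) : F.IsIso R R g := by
  refine hg.restrict_eq hR (Set.Subset.antisymm ?_ fun b hb => ?_)
  · rintro _ ⟨r, hr, rfl⟩
    exact hκ ⟨r, hr⟩ ▸ (κ ⟨r, hr⟩).2
  · exact ⟨κ⁻¹ ⟨b, hb⟩, Subtype.prop _, by rw [← hκ, MulAut.apply_inv_self]⟩

theorem isNormalIn_of_eq_normalizer (h : F.toPrefusionSystem = F.normalizer R) :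
    F.IsNormalIn R := by
  intro A B f hf
  obtain ⟨e, he, hef⟩ := id hf
  obtain ⟨-, -, -, φ, hφ, hφe, κ, hκ⟩ : e.toMonoidHom ∈ (F.normalizer R).Hom A B := h ▸ he
  obtain ⟨g, hφg, hg⟩ := exists_isIso_of_mem hφ
  have hgR : F.IsIso R R g :=
    isIso_of_exists_mulAut hg le_sup_left fun r => (hκ r).symm.trans (hφg _)
  have hgf : Set.EqOn g f A := fun a ha =>
    (hφg _).symm.trans ((hφe ⟨a, ha⟩).trans (hef ⟨a, ha⟩))
  exact ⟨g, hg.sup le_sup_left le_sup_right hgR (hf.congr hgf.symm), hgR, hgf⟩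

theorem isNormalIn_bot : F.IsNormalIn ⊥ := by
  refine fun A B f hf => ⟨f, by simpa only [bot_sup_eq] using hf, ?_, fun _ _ => rfl⟩
  exact hf.restrict_eq bot_le (by simp [hf.map_one])

namespace IsNormalIn

theorem exists_aut (hR : F.IsNormalIn R) (hf : F.IsIso A B f) :
    ∃ g, F.IsIso R R g ∧ Set.EqOn g f A :=
  let ⟨g, _, hg, hgf⟩ := hR A B f hf
  ⟨g, hg, hgf⟩

theorem le (hR : F.IsNormalIn R) : R ≤ F.carrier :=
  let ⟨_, hg, _⟩ := hR.exists_aut (IsIso.refl (F := F) bot_le)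
  hg.le_left

theorem le_normalizer (hR : F.IsNormalIn R) : F.carrier ≤ Subgroup.normalizer (R : Set G) := by
  refine Subgroup.le_normalizer_iff.2 fun x hx r hr => ?_
  obtain ⟨g, hg, hgx⟩ := hR.exists_aut (isIso_conj (inv_mem hx))
  have := hgx (hR.le hr) ▸ hg.mapsTo hr
  rwa [inv_inv] at this

theorem eq_normalizer (hR : F.IsNormalIn R) : F.toPrefusionSystem = F.normalizer R := by
  have hc : F.carrier = F.normalizerIn R := (inf_eq_left.2 hR.le_normalizer).symm
  refine PrefusionSystem.ext hc (funext fun A => funext fun B => Set.ext fun φ =>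
    ⟨fun hφ => ?_, fun hφ => hφ.2.2.1⟩)
  obtain ⟨hA, hB⟩ := F.le_carrier hφ
  obtain ⟨f, hφf, hf⟩ := exists_isIso_of_mem hφ
  obtain ⟨g, hg, ⟨κ, -, hκ⟩, hgf⟩ := hR _ _ f hf
  have hle : imageSubgroup φ ≤ B := by
    rintro _ ⟨a, rfl⟩
    exact (φ a).2
  obtain ⟨φ', hφ', hφg⟩ := hg.exists_hom (sup_le_sup_left hle R) (sup_le hR.le hB)
  exact ⟨hc ▸ hA, hc ▸ hB, hφ, φ', hφ', fun a => (hφg _).trans ((hgf a.2).trans (hφf a).symm),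
    κ, fun r => (hφg _).trans (hκ r).symm⟩

theorem sup (hR : F.IsNormalIn R) (hS : F.IsNormalIn S) : F.IsNormalIn (R ⊔ S) := by
  intro A B f hf
  obtain ⟨g, hg, hgS, hgf⟩ := hS A B f hf
  obtain ⟨k, hk, hkR, hkg⟩ := hR _ _ g hg
  have hS' : (S : Set G) ⊆ ↑(S ⊔ A) := SetLike.coe_subset_coe.2 le_sup_left
  have hA' : (A : Set G) ⊆ ↑(S ⊔ A) := SetLike.coe_subset_coe.2 le_sup_right
  have hkS : F.IsIso S S k := hgS.congr (hkg.symm.mono hS')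
  exact ⟨k, by rwa [sup_assoc, sup_assoc],
    hk.sup le_sup_left (le_sup_left.trans le_sup_right) hkR hkS, (hkg.mono hA').trans hgf⟩

end IsNormalIn

theorem isNormalIn_iff : F.IsNormalIn R ↔ F.toPrefusionSystem = F.normalizer R :=
  ⟨IsNormalIn.eq_normalizer, isNormalIn_of_eq_normalizer⟩

theorem isNormalIn_sSup {s : Set (Subgroup G)} (hs : s.Finite) (h : ∀ T ∈ s, F.IsNormalIn T) :
    F.IsNormalIn (sSup s) := by
  induction s, hs using Set.Finite.induction_on with
  | empty => simpa only [sSup_empty] using isNormalIn_bot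
  | insert _ _ ih =>
    rw [sSup_insert]
    exact (h _ (Set.mem_insert _ _)).sup (ih fun T hT => h T (Set.mem_insert_of_mem _ hT))

theorem finite_setOf_isConjugate [Finite F.carrier] (R : Subgroup G) :
    {T | F.IsConjugate R T}.Finite := by
  have hfin : (F.carrier : Set G).Finite := Set.toFinite _
  refine Set.Finite.of_finite_image (f := fun T : Subgroup G => (T : Set G))
    (hfin.finite_subsets.subset ?_) SetLike.coe_injective.injOn
  rintro _ ⟨T, hT, rfl⟩
  exact (F.le_carrier hT.choose_spec).2

namespace IsInvariantSubsystem

theorem comp_isIso_of_invOn (hE : IsInvariantSubsystem E F)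
    (hf : F.IsIso E.carrier E.carrier f) (hgf : Set.InvOn g f E.carrier E.carrier)
    (hk : E.IsIso A B k) (hA : F.IsIso A A' f) (hB : F.IsIso B B' f) :
    E.IsIso A' B' (f ∘ k ∘ g) :=
  hE.conj_isIso hk hf le_rfl hk.le_left hk.le_right hA hB fun _ ha =>
    congrArg (f ∘ k) (hgf.1 (hk.le_left ha))

theorem isNormalIn_of_isIso (hE : IsInvariantSubsystem E F) (hR : E.IsNormalIn R)
    (hf : F.IsIso E.carrier E.carrier f) (hS : F.IsIso R S f) : E.IsNormalIn S := by
  intro A B k hk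
  obtain ⟨σ, hσ, hσf⟩ := hf.symm
  have hA := hk.le_left
  have hB := hk.le_right
  obtain ⟨A₀, -, hAσ⟩ := hσ.restrict hA
  obtain ⟨B₀, -, hBσ⟩ := hσ.restrict hB
  have hA₀ : F.IsIso A₀ A f := hσ.restrict_symm hσf.symm hA hAσ hf
  have hB₀ : F.IsIso B₀ B f := hσ.restrict_symm hσf.symm hB hBσ hf
  have hk₀ : E.IsIso A₀ B₀ (σ ∘ k ∘ f) := hE.comp_isIso_of_invOn hσ hσf.symm hk hAσ hBσ
  obtain ⟨g, hg, hgR, hgk⟩ := hR _ _ _ hk₀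
  refine ⟨f ∘ g ∘ σ, hE.comp_isIso_of_invOn hf hσf hg (hf.sup hR.le hk₀.le_left hS hA₀)
    (hf.sup hR.le hk₀.le_right hS hB₀), hE.comp_isIso_of_invOn hf hσf hgR hS hS, fun a ha => ?_⟩
  calc f (g (σ a)) = f (σ (k (f (σ a)))) := congrArg f (hgk (hAσ.mapsTo ha))
    _ = f (σ (k a)) := congrArg (f ∘ σ ∘ k) (hσf.2 (hA ha))
    _ = k a := hσf.2 (hB (hk.mapsTo ha))

variable [Finite F.carrier]

theorem isIso_sSup_conjugates (hE : IsInvariantSubsystem E F) (hR : R ≤ E.carrier)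
    (hf : F.IsIso E.carrier E.carrier f) :
    F.IsIso (sSup {T | F.IsConjugate R T}) (sSup {T | F.IsConjugate R T}) f := by
  have hle : ∀ T, F.IsConjugate R T → T ≤ E.carrier := fun T hT =>
    let ⟨_, hk⟩ := isConjugate_iff.1 hT
    hE.le_of_isIso hk hR
  obtain ⟨S, -, hS⟩ := hf.restrict (sSup_le hle)
  obtain ⟨σ, hσ, hσf⟩ := hf.symm
  have hSS : sSup {T | F.IsConjugate R T} = S := by
    have : Finite S := finite_of_le hS.le_right
    refine Subgroup.eq_of_le_of_card_ge (sSup_le fun T hT t ht => ?_) hS.card_eq.ge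
    obtain ⟨k, hk⟩ := isConjugate_iff.1 hT
    obtain ⟨T', -, hT'⟩ := hσ.restrict (hle T hT)
    rw [← hσf.2 (hle T hT ht)]
    exact hS.mapsTo (le_sSup (a := T') (hk.comp hT').isConjugate (hT'.mapsTo ht))
  rwa [← hSS] at hS

variable [Fact p.Prime]

theorem isNormalIn_of_isConjugate (hE : IsInvariantSubsystem E F) (hP : IsPGroup p F.carrier)
    (hF : F.IsSaturated p) (hR : E.IsNormalIn R) (hS : F.IsConjugate R S) : E.IsNormalIn S := by
  obtain ⟨f, hf⟩ := isConjugate_iff.1 hS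
  obtain ⟨α, β, T, hα, hRα, hβ, -⟩ := hE.hasFrattiniFactorization hP hF hR.le hf
  have hT := hE.isNormalIn_of_isIso hR hα hRα
  obtain ⟨g, hg, hgβ⟩ := hT.exists_aut hβ
  exact hg.unique hβ hgβ ▸ hT

theorem isNormalIn_sSup_conjugates (hE : IsInvariantSubsystem E F) (hP : IsPGroup p F.carrier)
    (hF : F.IsSaturated p) (hR : E.IsNormalIn R) :
    E.IsNormalIn (sSup {T | F.IsConjugate R T}) :=
  isNormalIn_sSup (finite_setOf_isConjugate R) fun _ hT =>
    hE.isNormalIn_of_isConjugate hP hF hR hT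

theorem isStronglyClosed_of_forall_mapsTo (hE : IsInvariantSubsystem E F)
    (hP : IsPGroup p F.carrier) (hF : F.IsSaturated p) (hS : E.IsNormalIn S)
    (hSα : ∀ α, F.IsIso E.carrier E.carrier α → F.IsIso S S α) (hA : A ≤ S)
    (hAα : ∀ α, F.IsIso S S α → Set.MapsTo α A A) : F.IsStronglyClosed A := by
  have hAE : A ≤ E.carrier := hA.trans hS.le
  refine isStronglyClosed_iff.2 ⟨hAE.trans hE.isSubsystem.1, fun B C f hf hBA b hb => ?_⟩
  obtain ⟨a, ha, rfl⟩ := hf.bijOn.surjOn hb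
  obtain ⟨α, β, T, hα, hBα, hβ, hβα⟩ := hE.hasFrattiniFactorization hP hF (hBA.trans hAE) hf
  obtain ⟨g, hg, hgβ⟩ := hS.exists_aut hβ
  rw [← hβα ha, Function.comp_apply, ← hgβ (hBα.mapsTo ha)]
  exact hAα g (hE.isSubsystem.isIso hg) (hAα α (hSα α hα) (hBA ha))

end IsInvariantSubsystem

end FusionSystem

/-! ### Chains centralized by a strongly closed subgroup -/

namespace FusionSystem

variable {G : Type*} [Group G] {p : ℕ} {E F : FusionSystem G} {A B C S : Subgroup G}
  {f : G → G} {D : ℕ → Subgroup G}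

/-- The chain `D` of strongly `F`-closed subgroups leads from the group on which `F` is defined
down to the trivial group, and `S` centralizes its factors `D i / D (i + 1)`. -/
structure IsCentralizedChain (F : FusionSystem G) (S : Subgroup G) (D : ℕ → Subgroup G) :
    Prop where
  isStronglyClosed : ∀ i, F.IsStronglyClosed (D i)
  zero_eq : D 0 = F.carrier
  exists_eq_bot : ∃ m, D m = ⊥
  commutator_le : ∀ i, ⁅D i, S⁆ ≤ D (i + 1)

namespace IsCentralizedChain

theorem conjAut_le_chainStabilizer (hD : F.IsCentralizedChain S D) (hS : S ≤ F.carrier) :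
    conjAut S A ≤ chainStabilizer fun i => (D i).subgroupOf A := by
  intro u hu i
  obtain ⟨x, hx, hux⟩ := mem_conjAut.1 hu
  refine ⟨fun a => ?_, fun a ha => ?_⟩
  · rw [Subgroup.mem_subgroupOf, Subgroup.mem_subgroupOf, hux]
    exact (Subgroup.mem_normalizer_iff''.1
      ((hD.isStronglyClosed i).le_normalizer (hS hx.1)) a).symm
  · have := hD.commutator_le i (Subgroup.commutator_mem_commutator
      (inv_mem (Subgroup.mem_subgroupOf.1 ha)) (inv_mem hx.1))
    rw [Subgroup.mem_subgroupOf, Subgroup.coe_mul, hux, Subgroup.coe_inv]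
    rwa [commutatorElement_def, inv_inv, inv_inv, mul_assoc, mul_assoc, ← mul_assoc x⁻¹] at this

theorem congr_mem_chainStabilizer (hD : F.IsCentralizedChain S D) {e : A ≃* C}
    (he : e.toMonoidHom ∈ F.Hom A C) {u : MulAut A}
    (hu : u ∈ chainStabilizer fun i => (D i).subgroupOf A) :
    MulAut.congr e u ∈ chainStabilizer fun i => (D i).subgroupOf C := by
  obtain ⟨f, hef, hf⟩ := exists_isIso_of_equiv he
  refine _root_.congr_mem_chainStabilizer (fun i a => ?_) hu
  rw [Subgroup.mem_subgroupOf, Subgroup.mem_subgroupOf, hef]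
  exact (hD.isStronglyClosed i).mem_iff hf a.2

variable [Fact p.Prime] [Finite F.carrier]

theorem chainStabilizer_inf_aut_le_conjAut (hD : F.IsCentralizedChain S D)
    (hP : IsPGroup p F.carrier) (hF : F.IsSaturated p) (hC : C ≤ F.carrier)
    (hfn : F.IsFullyNormalized C) :
    (chainStabilizer fun i => (D i).subgroupOf C) ⊓ F.aut C hC ≤ conjAut F.carrier C := by
  have : Finite C := finite_of_le hC
  obtain ⟨m, hm⟩ := hD.exists_eq_bot
  have hp : IsPGroup p (chainStabilizer fun i => (D i).subgroupOf C) :=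
    isPGroup_chainStabilizer (hP.to_le hC) (m := m)
      (Subgroup.subgroupOf_eq_top.2 (hD.zero_eq ▸ hC)) (by simp [hm])
  refine (isSylowIn_conjAut hP hF hC hfn).le_of_normal (hp.to_le inf_le_left) inf_le_right ?_
  exact Subgroup.le_normalizer_iff.2 fun γ hγ u hu =>
    ⟨hD.congr_mem_chainStabilizer hγ hu.1, congr_mem_aut hγ hu.2⟩

theorem exists_extension_sup_inf_normalizer (hD : F.IsCentralizedChain S D)
    (hP : IsPGroup p F.carrier) (hF : F.IsSaturated p) (hS : S ≤ F.carrier)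
    (hf : F.IsIso A C f) (hC : F.IsFullyNormalized C) :
    ∃ g B, F.IsIso (A ⊔ S ⊓ Subgroup.normalizer (A : Set G)) B g ∧ Set.EqOn g f A := by
  obtain ⟨e, he, hef⟩ := hf
  obtain ⟨g, B, hg, hge⟩ := hF.exists_extension (N := S ⊓ Subgroup.normalizer (A : Set G)) he hC
    (inf_le_inf_right _ hS) (by
      rintro _ ⟨u, hu, rfl⟩
      have huS : u ∈ conjAut S A := conjAut_mono inf_le_left hu
      exact hD.chainStabilizer_inf_aut_le_conjAut hP hF (F.le_carrier he).2 hC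
        ⟨hD.congr_mem_chainStabilizer he (hD.conjAut_le_chainStabilizer hS huS),
          congr_mem_aut he (conjAut_le_aut _ (conjAut_mono hS huS))⟩)
  exact ⟨g, B, hg, fun a ha => (hge ⟨a, ha⟩).trans (hef ⟨a, ha⟩)⟩

theorem exists_extension_sup_of_isFullyNormalized (hD : F.IsCentralizedChain S D)
    (hP : IsPGroup p F.carrier) (hF : F.IsSaturated p) (hS : F.IsStronglyClosed S)
    (hf : F.IsIso A C f) (hC : F.IsFullyNormalized C)
    (ih : ∀ N ≤ F.carrier, Nat.card A < Nat.card N → ∀ B g, F.IsIso N B g →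
      ∃ k T, F.IsIso (S ⊔ N) T k ∧ Set.EqOn k g N) :
    ∃ g T, F.IsIso (S ⊔ A) T g ∧ Set.EqOn g f A := by
  by_cases hSA : S ≤ A
  · exact ⟨f, C, by rwa [sup_eq_right.2 hSA], fun _ _ => rfl⟩
  obtain ⟨g, B, hg, hgf⟩ := hD.exists_extension_sup_inf_normalizer hP hF hS.1 hf hC
  have hSAF := sup_le hS.1 hf.le_left
  have : Finite ↥(S ⊔ A) := finite_of_le hSAF
  have := (hP.to_le hSAF).isNilpotent
  have := finite_of_le hg.le_left
  obtain ⟨k, T, hk, hkg⟩ := ih _ hg.le_left (card_lt_card_of_lt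
    (lt_sup_inf_normalizer (hf.le_left.trans hS.le_normalizer) hSA)) B g hg
  rw [← sup_assoc, sup_eq_left.2 (inf_le_left.trans le_sup_left)] at hk
  exact ⟨k, T, hk, (hkg.mono (SetLike.coe_subset_coe.2 le_sup_left)).trans hgf⟩

theorem exists_extension_sup (hD : F.IsCentralizedChain S D) (hP : IsPGroup p F.carrier)
    (hF : F.IsSaturated p) (hS : F.IsStronglyClosed S) (hf : F.IsIso A B f) :
    ∃ g T, F.IsIso (S ⊔ A) T g ∧ Set.EqOn g f A := by
  have : Finite S := finite_of_le hS.1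
  refine induction_on_larger_card (motive := fun A => ∀ B f, F.IsIso A B f →
    ∃ g T, F.IsIso (S ⊔ A) T g ∧ Set.EqOn g f A) (fun A _ ih B f hf => ?_) hf.le_left B f hf
  obtain ⟨C, k, hk, hC⟩ := exists_isFullyNormalized hf.le_right
  obtain ⟨g, T, hg, hgk⟩ :=
    hD.exists_extension_sup_of_isFullyNormalized hP hF hS (hf.comp hk) hC ih
  obtain ⟨h, U, hh, hhk⟩ :=
    hD.exists_extension_sup_of_isFullyNormalized hP hF hS hk hC (hf.card_eq ▸ ih)
  obtain ⟨l, hl, hlh⟩ := (hS.isIso_sup hk hh hhk).2.symm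
  refine ⟨l ∘ g, _, (hS.isIso_sup (hf.comp hk) hg hgk).2.comp hl, fun a ha => ?_⟩
  have hfa := hf.mapsTo ha
  calc l (g a) = l (h (f a)) := congrArg l ((hgk ha).trans (hhk hfa).symm)
    _ = f a := hlh.1 (Subgroup.mem_sup_right hfa)

theorem isNormalIn (hD : F.IsCentralizedChain S D) (hP : IsPGroup p F.carrier)
    (hF : F.IsSaturated p) (hS : F.IsStronglyClosed S) : F.IsNormalIn S := by
  intro A B f hf
  have : Finite S := finite_of_le hS.1
  obtain ⟨g, T, hg, hgf⟩ := hD.exists_extension_sup hP hF hS hf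
  obtain ⟨hgS, hgSA⟩ := hS.isIso_sup hf hg hgf
  exact ⟨g, hgSA, hgS, hgf⟩

end IsCentralizedChain

theorem IsIso.mapsTo_lowerCentralSeries (hf : F.IsIso S S f) (n : ℕ) :
    Set.MapsTo f (S.lowerCentralSeries n) (S.lowerCentralSeries n) := by
  obtain ⟨e, -, hef⟩ := hf
  rw [← Subgroup.top_subtype_lowerCentralSeries]
  rintro _ ⟨x, hx, rfl⟩
  have hchar : (Subgroup.lowerCentralSeries (⊤ : Subgroup S) n).Characteristic := inferInstance
  exact ⟨e x, Subgroup.characteristic_iff_le_comap.1 hchar e hx, hef x⟩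

/-- The chain `P ≥ S ≥ [S, S] ≥ ⋯`: the group `P` on which `F` is defined, followed by the lower
central series of `S`. -/
def lowerCentralChain (F : FusionSystem G) (S : Subgroup G) : ℕ → Subgroup G
  | 0 => F.carrier
  | i + 1 => S.lowerCentralSeries i

theorem isCentralizedChain_lowerCentralChain [Group.IsNilpotent S]
    (hS : ∀ i, F.IsStronglyClosed (S.lowerCentralSeries i)) :
    F.IsCentralizedChain S (F.lowerCentralChain S) where
  isStronglyClosed
    | 0 => isStronglyClosed_carrier
    | i + 1 => hS i
  zero_eq := rfl
  exists_eq_bot :=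
    let ⟨n, hn⟩ := (Subgroup.isNilpotent_iff_lowerCentralSeries S).1 inferInstance
    ⟨n + 1, hn⟩
  commutator_le
    | 0 => Subgroup.le_normalizer_iff_commutator_le_right.1 (hS 0).le_normalizer
    | _ + 1 => le_rfl

theorem IsInvariantSubsystem.isNormalIn_of_forall_isIso [Fact p.Prime] [Finite F.carrier]
    (hE : IsInvariantSubsystem E F) (hP : IsPGroup p F.carrier) (hF : F.IsSaturated p)
    (hS : E.IsNormalIn S) (hSα : ∀ α, F.IsIso E.carrier E.carrier α → F.IsIso S S α) :
    F.IsNormalIn S := by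
  have hSF : S ≤ F.carrier := hS.le.trans hE.isSubsystem.1
  have : Finite S := finite_of_le hSF
  have := (hP.to_le hSF).isNilpotent
  have hclosed (i : ℕ) : F.IsStronglyClosed (S.lowerCentralSeries i) :=
    hE.isStronglyClosed_of_forall_mapsTo hP hF hS hSα (S.lowerCentralSeries_le_self i)
      fun _ hα => hα.mapsTo_lowerCentralSeries i
  exact (isCentralizedChain_lowerCentralChain hclosed).isNormalIn hP hF (hclosed 0)

end FusionSystem

theorem theoremB_general {G : Type*} [Group G] (p : ℕ) [Fact p.Prime] (F E : FusionSystem G)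
    [Finite F.carrier] (hP : IsPGroup p F.carrier) (hF : F.IsSaturated p)
    (hE : FusionSystem.IsInvariantSubsystem E F) (R : Subgroup G)
    (hR : E.toPrefusionSystem = E.normalizer R) :
    F.toPrefusionSystem = F.normalizer (sSup {T : Subgroup G | F.IsConjugate R T}) := by
  have hRE : E.IsNormalIn R := FusionSystem.isNormalIn_iff.2 hR
  have hSE : E.IsNormalIn (sSup {T | F.IsConjugate R T}) :=
    hE.isNormalIn_sSup_conjugates hP hF hRE
  exact FusionSystem.isNormalIn_iff.1 (hE.isNormalIn_of_forall_isIso hP hF hSE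
    fun _ hα => hE.isIso_sSup_conjugates hRE.le hα)

theorem theoremB {G : Type*} [Group G] (p : ℕ) [Fact p.Prime] (F E : FusionSystem G)
    [Finite F.carrier] (hP : IsPGroup p F.carrier) (hF : F.IsSaturated p)
    (hE : FusionSystem.IsNormalSubsystem p E F)
    (R : Subgroup G) (hRQ : R ≤ E.carrier)
    (hR : E.toPrefusionSystem = E.normalizer R) :
    F.toPrefusionSystem = F.normalizer (sSup {T : Subgroup G | F.IsConjugate R T}) :=
  theoremB_general p F E hP hF hE.isInvariantSubsystem R hR
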